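/- Let $d\ge 1$ and let $R$ be a commutative ring with a fixed ring homomorphism $R\to\mathbb R$ (for example $R=\mathbb Z$ or $R=\mathbb R$). For $n\ge 0$, a (piecewise-linear simplicial) $n$-chain in $\mathbb R^d$ is a finite formal $R$-linear combination of oriented nondegenerate $n$-simplices $[v_0,\dots,v_n]$ with affinely independent vertices $v_0,\dots,v_n\in\mathbb R^d$, where $[v_{\sigma(0)},\dots,v_{\sigma(n)}]=\operatorname{sgn}(\sigma)\,[v_0,\dots,v_n]$ for every permutation $\sigma$; the simplices of a chain may overlap. Its boundary is determined by $\partial[v_0,\dots,v_n]=\sum_{i=0}^n(-1)^i[v_0,\dots,\widehat{v_i},\dots,v_n]$ for $n\ge1$. A chain of dimension $n\ge 1$ is a cycle if its boundary is zero, and a $0$-chain is a cycle if its coefficients sum to $0$. For a nondegenerate $d$-simplex $\Delta=[v_0,\dots,v_d]$ in $\mathbb R^d$ let $\mathbf o_\Delta$ be its circumcenter and let $\operatorname{Vol}(\Delta)$ be its signed volume, that is, the Lebesgue measure of its convex hull multiplied by the sign of $\det(v_1-v_0,\dots,v_d-v_0)$. For a $d$-chain $K=\sum_i a_i\Delta_i$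 in $\mathbb R^d$ put $$\operatorname{Vol}(K)=\sum_i a_i\operatorname{Vol}(\Delta_i),\qquad M(K)=\sum_i a_i\operatorname{Vol}(\Delta_i)\,\mathbf o_{\Delta_i},$$ and, if $\operatorname{Vol}(K)\ne0$, call $\operatorname{Vol}(K)^{-1}M(K)$ the circumcenter of mass of $K$. 1. If $\mathcal C$ is a $d$-dimensional cycle in $\mathbb R^d$, then $M(\mathcal C)=\sum_i a_i\operatorname{Vol}(\Delta_i)\,\mathbf o_{\Delta_i}=\mathbf 0$. 2. Let $\mathcal C$ be a $(d-1)$-dimensional cycle in $\mathbb R^d$. Then there is a $d$-chain $K$ in $\mathbb R^d$ with $\partial K=\mathcal C$ (a filling of $\mathcal C$). Any two fillings $K,K'$ of $\mathcal C$ satisfy $\operatorname{Vol}(K)=\operatorname{Vol}(K')$ and $M(K)=M(K')$; hence, if this volume is nonzero, they have the same circumcenter of mass. So the circumcenter of mass of $\mathcal C$ is well defined and does not depend on the filling. -/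

import Mathlib

/-!
Oriented simplicial chains of nondegenerate affine simplices in Euclidean space, their boundary,
signed volume, and volume-weighted circumcenters.
-/

noncomputable section

namespace PLChain

/-- Euclidean space `ℝᵈ`. -/
abbrev E (d : ℕ) : Type := EuclideanSpace ℝ (Fin d)

/-- Nondegenerate `n`-dimensional simplices in `ℝᵈ` with ordered, affinely independent vertices
`v₀, …, vₙ`. -/
abbrev Splx (d n : ℕ) : Type := Affine.Simplex ℝ (E d) n

/-- The relations of oriented simplices: permuting the vertices of a simplex by `σ` multiplies it by
the sign of `σ`. -/
def orientationRelations (R : Type*) [CommRing R] (d n : ℕ) : Submodule R (Splx d n →₀ R) :=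
  Submodule.span R
    {x | ∃ (s : Splx d n) (σ : Equiv.Perm (Fin (n + 1))),
      x = Finsupp.single (s.reindex σ) (1 : R) -
        Finsupp.single s (((Equiv.Perm.sign σ : ℤˣ) : ℤ) : R)}

/-- Oriented `n`-dimensional piecewise-linear simplicial chains in `ℝᵈ` with coefficients in `R`:
formal finite `R`-linear combinations of oriented nondegenerate simplices. -/
abbrev Chain (R : Type*) [CommRing R] (d n : ℕ) : Type _ :=
  (Splx d n →₀ R) ⧸ orientationRelations R d n

/-- The oriented simplex `[v₀, …, vₙ]` as a chain. -/
def oriented (R : Type*) [CommRing R] {d n : ℕ} (s : Splx d n) : Chain R d n :=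
  (orientationRelations R d n).mkQ (Finsupp.single s 1)

/-- The facet `(v₀, …, v̂ᵢ, …, vₙ₊₁)` opposite to the vertex `vᵢ`. -/
def facet {d n : ℕ} (s : Splx d (n + 1)) (i : Fin (n + 2)) : Splx d n :=
  ⟨fun j => s.points (i.succAbove j), s.independent.comp_embedding (Fin.succAboveEmb i)⟩

theorem orientationRelations_le_ker {R : Type*} [CommRing R] {M : Type*} [AddCommGroup M]
    [Module R M] {d n : ℕ} (f : Splx d n → M)
    (hf : ∀ (s : Splx d n) (σ : Equiv.Perm (Fin (n + 1))),
      f (s.reindex σ) = ((Equiv.Perm.sign σ : ℤˣ) : ℤ) • f s) :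
    orientationRelations R d n ≤ LinearMap.ker (Finsupp.linearCombination R f) := by
  refine Submodule.span_le.2 ?_
  rintro x ⟨s, σ, rfl⟩
  simp [hf, Int.cast_smul_eq_zsmul]

/-- Linear extension of a function on ordered simplices that is multiplied by the sign when the
vertices are permuted. -/
def liftAlternating {R : Type*} [CommRing R] {M : Type*} [AddCommGroup M] [Module R M] {d n : ℕ}
    (f : Splx d n → M)
    (hf : ∀ (s : Splx d n) (σ : Equiv.Perm (Fin (n + 1))),
      f (s.reindex σ) = ((Equiv.Perm.sign σ : ℤˣ) : ℤ) • f s) :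
    Chain R d n →ₗ[R] M :=
  (orientationRelations R d n).liftQ (Finsupp.linearCombination R f)
    (orientationRelations_le_ker f hf)

theorem oriented_reindex (R : Type*) [CommRing R] {d n : ℕ} (s : Splx d n)
    (σ : Equiv.Perm (Fin (n + 1))) :
    oriented R (s.reindex σ) = ((Equiv.Perm.sign σ : ℤˣ) : ℤ) • oriented R s := by
  have h : (orientationRelations R d n).mkQ (Finsupp.single (s.reindex σ) (1 : R)) =
      (orientationRelations R d n).mkQ
        (Finsupp.single s (((Equiv.Perm.sign σ : ℤˣ) : ℤ) : R)) := by
    rw [← sub_eq_zero, ← map_sub, Submodule.mkQ_apply, Submodule.Quotient.mk_eq_zero]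
    exact Submodule.subset_span ⟨s, σ, rfl⟩
  have h2 : Finsupp.single s (((Equiv.Perm.sign σ : ℤˣ) : ℤ) : R) =
      ((Equiv.Perm.sign σ : ℤˣ) : ℤ) • Finsupp.single s (1 : R) := by
    rw [Finsupp.smul_single, zsmul_one]
  unfold oriented
  rw [h, h2, map_zsmul]

theorem liftAlternating_oriented {R : Type*} [CommRing R] {M : Type*} [AddCommGroup M] [Module R M]
    {d n : ℕ} (f : Splx d n → M)
    (hf : ∀ (s : Splx d n) (σ : Equiv.Perm (Fin (n + 1))),
      f (s.reindex σ) = ((Equiv.Perm.sign σ : ℤˣ) : ℤ) • f s) (s : Splx d n) :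
    liftAlternating f hf (oriented R s) = f s := by
  unfold liftAlternating oriented
  rw [Submodule.mkQ_apply, Submodule.liftQ_apply, Finsupp.linearCombination_single, one_smul]

/-- A permutation `σ` carries the facet opposite to `i` to the one opposite to `σ i` by a permutation
of sign `(-1) ^ (i + σ i) * sign σ`. -/
theorem exists_facePerm {n : ℕ} (σ : Equiv.Perm (Fin (n + 2))) (i : Fin (n + 2)) :
    ∃ τ : Equiv.Perm (Fin (n + 1)), (∀ j, σ (i.succAbove j) = (σ i).succAbove (τ j)) ∧
      Equiv.Perm.sign τ = (-1) ^ ((i : ℕ) + (σ i : ℕ)) * Equiv.Perm.sign σ := by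
  set ρ : Equiv.Perm (Fin (n + 2)) := (σ i).cycleRange * σ * i.cycleRange⁻¹ with hρ
  obtain ⟨⟨p, τ⟩, hp⟩ := Equiv.Perm.decomposeFin.symm.surjective ρ
  have h0 : ρ 0 = 0 := by
    simp [hρ]
  have hp0 : p = 0 := by
    rw [← Equiv.Perm.decomposeFin_symm_apply_zero p τ, hp, h0]
  subst hp0
  refine ⟨τ, fun j => ?_, ?_⟩
  · have h1 : ρ j.succ = (τ j).succ := by
      rw [← hp, Equiv.Perm.decomposeFin_symm_apply_succ]; simp
    have h2 : i.cycleRange⁻¹ j.succ = i.succAbove j := Fin.cycleRange_symm_succ i j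
    have h3 : (σ i).cycleRange (σ (i.succAbove j)) = (τ j).succ := by
      rw [← h1, hρ, Equiv.Perm.mul_apply, Equiv.Perm.mul_apply, h2]
    rw [← Fin.cycleRange_symm_succ (σ i), ← h3, Equiv.symm_apply_apply]
  · have hs := congrArg Equiv.Perm.sign hp
    rw [Equiv.Perm.decomposeFin.symm_sign, if_pos rfl, one_mul, hρ] at hs
    rw [hs, map_mul, map_mul, Equiv.Perm.sign_inv, Fin.sign_cycleRange, Fin.sign_cycleRange, pow_add]
    ac_rfl

theorem boundary_aux (R : Type*) [CommRing R] {d n : ℕ} (s : Splx d (n + 1))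
    (σ : Equiv.Perm (Fin (n + 2))) :
    ∑ i : Fin (n + 2), (-1 : ℤ) ^ (i : ℕ) • oriented R (facet (s.reindex σ) i) =
      ((Equiv.Perm.sign σ : ℤˣ) : ℤ) •
        ∑ i : Fin (n + 2), (-1 : ℤ) ^ (i : ℕ) • oriented R (facet s i) := by
  rw [Finset.smul_sum, ← Equiv.sum_comp σ.symm (fun i => ((Equiv.Perm.sign σ : ℤˣ) : ℤ) • _)]
  refine Finset.sum_congr rfl fun i _ => ?_
  obtain ⟨τ, h1, h2⟩ := exists_facePerm σ.symm i
  have hf : facet (s.reindex σ) i = (facet s (σ.symm i)).reindex τ.symm := by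
    ext j : 1
    simp [facet, Affine.Simplex.reindex, h1]
  rw [hf, oriented_reindex, smul_smul, smul_smul, Equiv.Perm.sign_symm, h2, Equiv.Perm.sign_symm]
  congr 1
  push_cast
  rw [← mul_assoc, ← pow_add, mul_comm]
  congr 1
  rw [← add_assoc, pow_add, ← two_mul, pow_mul]
  simp

/-- The boundary `∂[v₀, …, vₙ₊₁] = ∑ᵢ (-1)ⁱ [v₀, …, v̂ᵢ, …, vₙ₊₁]`. -/
def boundary {R : Type*} [CommRing R] {d n : ℕ} : Chain R d (n + 1) →ₗ[R] Chain R d n :=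
  liftAlternating (fun s => ∑ i : Fin (n + 2), (-1 : ℤ) ^ (i : ℕ) • oriented R (facet s i))
    (boundary_aux R)

/-- The sum of the coefficients of a `0`-chain. -/
def augmentation {R : Type*} [CommRing R] {d : ℕ} : Chain R d 0 →ₗ[R] R :=
  liftAlternating (fun _ => 1) (fun s σ => by
    have : σ = 1 := by
      ext j
      omega
    simp [this])

/-- Cycles: chains with zero boundary; in dimension `0`, chains whose coefficients sum to `0`. -/
def IsCycle {R : Type*} [CommRing R] {d : ℕ} : {n : ℕ} → Chain R d n → Prop
  | 0, c => augmentation c = 0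
  | _ + 1, c => boundary c = 0

/-- The orientation of a `d`-simplex in `ℝᵈ`: the sign of the determinant with rows `(1, vᵢ)`,
which equals `det (v₁ - v₀, …, v_d - v₀)`. -/
def orientationSign {d : ℕ} (s : Splx d d) : ℤ :=
  (SignType.sign (Matrix.det (Matrix.of fun i : Fin (d + 1) =>
    (Fin.cons 1 (fun j => s.points i j) : Fin (d + 1) → ℝ))) : SignType)

/-- The signed volume of a `d`-simplex in `ℝᵈ`: its Lebesgue measure with the sign of its
orientation. -/
def signedVolume {d : ℕ} (s : Splx d d) : ℝ :=
  orientationSign s * MeasureTheory.volume.real (convexHull ℝ (Set.range s.points))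

theorem orientationSign_reindex {d : ℕ} (s : Splx d d) (σ : Equiv.Perm (Fin (d + 1))) :
    orientationSign (s.reindex σ) = ((Equiv.Perm.sign σ : ℤˣ) : ℤ) * orientationSign s := by
  have h := Matrix.det_permute σ.symm (Matrix.of fun i : Fin (d + 1) =>
    (Fin.cons 1 (fun j => s.points i j) : Fin (d + 1) → ℝ))
  have h' : (Matrix.of fun i : Fin (d + 1) =>
      (Fin.cons 1 (fun j => (s.reindex σ).points i j) : Fin (d + 1) → ℝ)) =
      (Matrix.of fun i : Fin (d + 1) =>
      (Fin.cons 1 (fun j => s.points i j) : Fin (d + 1) → ℝ)).submatrix σ.symm id := rfl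
  rw [orientationSign, orientationSign, h', h, sign_mul, Equiv.Perm.sign_symm]
  rcases Int.units_eq_one_or (Equiv.Perm.sign σ) with hσ | hσ <;> simp [hσ]

theorem signedVolume_reindex {d : ℕ} (s : Splx d d) (σ : Equiv.Perm (Fin (d + 1))) :
    signedVolume (s.reindex σ) = ((Equiv.Perm.sign σ : ℤˣ) : ℤ) • signedVolume s := by
  rw [signedVolume, signedVolume, orientationSign_reindex, Affine.Simplex.reindex_range_points,
    zsmul_eq_mul]
  push_cast
  ring

/-- The total signed volume `∑ᵢ aᵢ Vol(Δᵢ)` of a chain `∑ᵢ aᵢ Δᵢ`. -/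
def totalVolume {R : Type*} [CommRing R] [Algebra R ℝ] {d : ℕ} : Chain R d d →ₗ[R] ℝ :=
  liftAlternating signedVolume signedVolume_reindex

/-- The volume-weighted sum of circumcenters `∑ᵢ aᵢ Vol(Δᵢ) oᵢ` of a chain `∑ᵢ aᵢ Δᵢ`. -/
def circumcenterSum {R : Type*} [CommRing R] [Algebra R ℝ] {d : ℕ} : Chain R d d →ₗ[R] E d :=
  liftAlternating (fun s => signedVolume s • s.circumcenter) (fun s σ => by
    rw [signedVolume_reindex, Affine.Simplex.circumcenter_reindex, smul_assoc])

/-- The circumcenter of mass of a chain: the center of mass of the circumcenters of its simplices,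
weighted by signed volume. It is meaningful when the total volume is nonzero. -/
def circumcenterOfMass {R : Type*} [CommRing R] [Algebra R ℝ] {d : ℕ} (K : Chain R d d) : E d :=
  (totalVolume K)⁻¹ • circumcenterSum K

end PLChain

end

/-! `totalVolume` and `circumcenterSum` both factor through `boundary`, which gives the vanishing on
cycles and the independence of the filling. The signed volume is a constant times the determinant
with rows `(1, vᵢ)`, and expanding along the column of ones leaves an alternating sum over facets
(`sum_faceDet_facet`). The equations `‖vᵢ - o‖² = r²` are linear in `o` and `(r² - ‖o‖²)/2`, with
the same matrix and right-hand side `‖vᵢ‖²/2`. By Cramer's rule `det * oₖ` is again a determinant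
with a column of ones (`det_homMatrix_halfSqCoords`), so it expands over facets too.

A filling is the cone over the cycle from a point off the finitely many affine spans of its
simplices. -/

noncomputable section

namespace PLChain

/-! ### Chains and linear maps on generators -/

section Extension

variable {R : Type*} [CommRing R] {d n : ℕ}

theorem chain_hom_ext {M : Type*} [AddCommGroup M] [Module R M] {f g : Chain R d n →ₗ[R] M}
    (h : ∀ s : Splx d n, f (oriented R s) = g (oriented R s)) : f = g := by
  refine Submodule.linearMap_qext _ (Finsupp.lhom_ext' fun s => LinearMap.ext_ring ?_)
  exact h s

theorem exists_sum_oriented (C : Chain R d n) :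
    ∃ x : Splx d n →₀ R, C = ∑ s ∈ x.support, x s • oriented R s := by
  obtain ⟨x, rfl⟩ := (orientationRelations R d n).mkQ_surjective C
  refine ⟨x, ?_⟩
  conv_lhs => rw [← x.sum_single, Finsupp.sum, map_sum]
  refine Finset.sum_congr rfl fun s _ => ?_
  rw [oriented, ← map_smul, Finsupp.smul_single, smul_eq_mul, mul_one]

theorem boundary_oriented (s : Splx d (n + 1)) :
    boundary (oriented R s) = ∑ i : Fin (n + 2), (-1 : ℤ) ^ (i : ℕ) • oriented R (facet s i) :=
  liftAlternating_oriented _ _ s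

end Extension

/-! ### Fillings by cones -/

section Cone

variable {R : Type*} [CommRing R] {d n : ℕ}

/-- The simplex `(p, v₀, …, vₙ)`. -/
def coneSimplex (p : E d) (s : Splx d n) (h : p ∉ affineSpan ℝ (Set.range s.points)) :
    Splx d (n + 1) :=
  ⟨Fin.cons p s.points, by
    refine AffineIndependent.affineIndependent_of_notMem_span (i := 0) ?_ ?_
    -- `finSuccAboveEquiv 0` identifies the nonzero indices with those of `s`.
    · have := (affineIndependent_equiv (finSuccAboveEquiv (0 : Fin (n + 2)))
        (k := ℝ) (p := fun x : {y // y ≠ (0 : Fin (n + 2))} =>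
          (Fin.cons p s.points : Fin (n + 2) → E d) x)).1 ?_
      · exact this
      · convert s.independent using 1
        ext j : 1
        simp [finSuccAboveEquiv_apply]
    · have : (Fin.cons p s.points : Fin (n + 2) → E d) '' {x | x ≠ 0} = Set.range s.points := by
        ext y
        constructor
        · rintro ⟨x, hx, rfl⟩
          obtain ⟨j, rfl⟩ := Fin.exists_succ_eq.2 hx
          exact ⟨j, by simp⟩
        · rintro ⟨j, rfl⟩
          exact ⟨j.succ, Fin.succ_ne_zero j, by simp⟩
      rw [this]
      simpa using h⟩

theorem facet_coneSimplex_zero (p : E d) (s : Splx d n)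
    (h : p ∉ affineSpan ℝ (Set.range s.points)) : facet (coneSimplex p s h) 0 = s := by
  ext j : 1
  simp [facet, coneSimplex]

theorem notMem_affineSpan_facet {p : E d} {s : Splx d (n + 1)}
    (h : p ∉ affineSpan ℝ (Set.range s.points)) (i : Fin (n + 2)) :
    p ∉ affineSpan ℝ (Set.range (facet s i).points) :=
  fun hp => h (affineSpan_mono ℝ (by rintro _ ⟨j, rfl⟩; exact ⟨_, rfl⟩) hp)

theorem facet_coneSimplex_succ (p : E d) (s : Splx d (n + 1))
    (h : p ∉ affineSpan ℝ (Set.range s.points)) (i : Fin (n + 2)) :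
    facet (coneSimplex p s h) i.succ =
      coneSimplex p (facet s i) (notMem_affineSpan_facet h i) := by
  ext j : 1
  refine Fin.cases ?_ (fun j => ?_) j <;> simp [facet, coneSimplex]

open Classical in
/-- The cone with apex `p` over a simplex, and zero if `p` is in the affine span of the simplex. -/
def coneOriented (R : Type*) [CommRing R] (p : E d) (s : Splx d n) : Chain R d (n + 1) :=
  if h : p ∉ affineSpan ℝ (Set.range s.points) then oriented R (coneSimplex p s h) else 0

theorem coneOriented_of_notMem {p : E d} {s : Splx d n}
    (h : p ∉ affineSpan ℝ (Set.range s.points)) :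
    coneOriented R p s = oriented R (coneSimplex p s h) := dif_pos h

theorem coneOriented_reindex (p : E d) (s : Splx d n) (σ : Equiv.Perm (Fin (n + 1))) :
    coneOriented R p (s.reindex σ) = ((Equiv.Perm.sign σ : ℤˣ) : ℤ) • coneOriented R p s := by
  by_cases h : p ∉ affineSpan ℝ (Set.range s.points)
  · have h' : p ∉ affineSpan ℝ (Set.range (s.reindex σ).points) := by
      rwa [Affine.Simplex.reindex_range_points]
    rw [coneOriented_of_notMem h, coneOriented_of_notMem h']
    -- The extension of `σ` that fixes the apex index `0` has the same sign as `σ`.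
    have hc : coneSimplex p (s.reindex σ) h' =
        (coneSimplex p s h).reindex (Equiv.Perm.decomposeFin.symm (0, σ)) := by
      ext j : 1
      change _ = (Fin.cons p s.points : Fin (n + 2) → E d)
        ((Equiv.Perm.decomposeFin.symm (0, σ)).symm j)
      refine Fin.cases ?_ (fun j => ?_) j
      · have : (Equiv.Perm.decomposeFin.symm (0, σ)).symm 0 = 0 := by
          rw [Equiv.symm_apply_eq]; simp
        rw [this]; rfl
      · have : (Equiv.Perm.decomposeFin.symm (0, σ)).symm j.succ = (σ.symm j).succ := by
          rw [Equiv.symm_apply_eq]; simp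
        rw [this]; rfl
    rw [hc, oriented_reindex, Equiv.Perm.decomposeFin.symm_sign, if_pos rfl, one_mul]
  · have h' : ¬ p ∉ affineSpan ℝ (Set.range (s.reindex σ).points) := by
      rwa [Affine.Simplex.reindex_range_points]
    rw [coneOriented, coneOriented, dif_neg h, dif_neg h', smul_zero]

/-- The cone with apex `p` over a chain, where simplices whose affine span contains `p` are
discarded. -/
def cone (R : Type*) [CommRing R] {d n : ℕ} (p : E d) : Chain R d n →ₗ[R] Chain R d (n + 1) :=
  liftAlternating (coneOriented R p) (coneOriented_reindex p)

theorem cone_oriented {p : E d} {s : Splx d n} (h : p ∉ affineSpan ℝ (Set.range s.points)) :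
    cone R p (oriented R s) = oriented R (coneSimplex p s h) := by
  rw [cone, liftAlternating_oriented, coneOriented_of_notMem h]

/-- Facet `0` of the cone is `s`; the others are cones over the facets of `s`, with index shifted by
one, hence the minus sign. -/
theorem boundary_cone_oriented {p : E d} {s : Splx d (n + 1)}
    (h : p ∉ affineSpan ℝ (Set.range s.points)) :
    boundary (cone R p (oriented R s)) = oriented R s - cone R p (boundary (oriented R s)) := by
  rw [cone_oriented h, boundary_oriented, Fin.sum_univ_succ, facet_coneSimplex_zero,
    boundary_oriented, map_sum, sub_eq_add_neg, ← Finset.sum_neg_distrib]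
  congr 1
  · simp
  · refine Finset.sum_congr rfl fun i _ => ?_
    rw [map_zsmul, cone_oriented (notMem_affineSpan_facet h i), facet_coneSimplex_succ,
      Fin.val_succ, pow_succ, mul_neg_one, neg_smul]

/-- In dimension `0` the second facet is the apex itself, so the augmentation takes the role of the
boundary. -/
theorem boundary_cone_oriented_zero {p : E d} {s : Splx d 0}
    (h : p ∉ affineSpan ℝ (Set.range s.points)) :
    boundary (cone R p (oriented R s)) =
      oriented R s - augmentation (oriented R s) • oriented R (Affine.Simplex.mkOfPoint ℝ p) := by
  have hf : facet (coneSimplex p s h) 1 = Affine.Simplex.mkOfPoint ℝ p := by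
    ext j : 1
    obtain rfl : j = 0 := by omega
    simp [facet, coneSimplex]
  have ha : augmentation (oriented R s) = 1 := liftAlternating_oriented _ _ s
  rw [cone_oriented h, boundary_oriented, Fin.sum_univ_two, facet_coneSimplex_zero, hf, ha]
  simp [sub_eq_add_neg]

/-- The homotopy formula can fail on simplices discarded by `cone`, so some presentation of `C` must
avoid them; the correction term then vanishes because `C` is a cycle. -/
theorem boundary_cone_eq_self {p : E d} {C : Chain R d n} (hC : IsCycle C) {x : Splx d n →₀ R}
    (hx : C = ∑ s ∈ x.support, x s • oriented R s)
    (hp : ∀ s ∈ x.support, p ∉ affineSpan ℝ (Set.range s.points)) :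
    boundary (cone R p C) = C := by
  cases n with
  | zero =>
    have key : boundary (cone R p C) =
        C - augmentation C • oriented R (Affine.Simplex.mkOfPoint ℝ p) := by
      rw [hx]
      simp only [map_sum, map_smul, Finset.sum_smul, ← Finset.sum_sub_distrib]
      refine Finset.sum_congr rfl fun s hs => ?_
      rw [boundary_cone_oriented_zero (hp s hs), smul_sub, smul_assoc]
    have h0 : augmentation C = 0 := hC
    rw [key, h0, zero_smul, sub_zero]
  | succ n =>
    have key : boundary (cone R p C) = C - cone R p (boundary C) := by
      rw [hx]
      simp only [map_sum, map_smul, ← Finset.sum_sub_distrib]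
      refine Finset.sum_congr rfl fun s hs => ?_
      rw [boundary_cone_oriented (hp s hs), smul_sub]
    have h0 : boundary C = 0 := hC
    rw [key, h0, map_zero, sub_zero]

theorem affineSpan_ne_top_of_lt {s : Splx d n} (h : n < d) :
    affineSpan ℝ (Set.range s.points) ≠ ⊤ := by
  intro ht
  have h1 := s.independent.finrank_vectorSpan (Fintype.card_fin (n + 1))
  rw [← direction_affineSpan, ht, AffineSubspace.direction_top, finrank_top,
    finrank_euclideanSpace_fin] at h1
  omega

/-- Finitely many proper affine subspaces have a union of measure zero. -/
theorem exists_notMem_affineSpan (S : Finset (Splx d n)) (h : n < d) :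
    ∃ p : E d, ∀ s ∈ S, p ∉ affineSpan ℝ (Set.range s.points) := by
  have h0 : MeasureTheory.volume
      (⋃ s ∈ S, (affineSpan ℝ (Set.range s.points) : Set (E d))) = 0 :=
    (MeasureTheory.measure_biUnion_null_iff S.countable_toSet).2 fun s _ =>
      MeasureTheory.Measure.addHaar_affineSubspace _ _ (affineSpan_ne_top_of_lt h)
  by_contra! hc
  have hu : (⋃ s ∈ S, (affineSpan ℝ (Set.range s.points) : Set (E d))) = Set.univ := by
    refine Set.eq_univ_of_forall fun p => ?_
    obtain ⟨s, hs, hp⟩ := hc p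
    exact Set.mem_biUnion hs hp
  rw [hu] at h0
  exact MeasureTheory.Measure.measure_univ_ne_zero.2 (NeZero.ne _) h0

/-- A cycle of dimension less than that of the ambient space bounds a chain. -/
theorem exists_boundary_eq {C : Chain R d n} (hC : IsCycle C) (h : n < d) :
    ∃ K : Chain R d (n + 1), boundary K = C := by
  obtain ⟨x, hx⟩ := exists_sum_oriented C
  obtain ⟨p, hp⟩ := exists_notMem_affineSpan x.support h
  exact ⟨cone R p C, boundary_cone_eq_self hC hx hp⟩

end Cone

/-! ### Facet expansion and Cramer's rule -/

section Determinants

variable {d n : ℕ}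

/-- The matrix with rows `(1, w vᵢ)`. -/
def homMatrix (w : E d → Fin d → ℝ) (s : Splx d d) : Matrix (Fin (d + 1)) (Fin (d + 1)) ℝ :=
  Matrix.of fun i => Fin.cons 1 (w (s.points i))

/-- The determinant of the matrix with rows `w vᵢ`, for a simplex of codimension one. -/
def faceDet (w : E (n + 1) → Fin (n + 1) → ℝ) (s : Splx (n + 1) n) : ℝ :=
  Matrix.det (Matrix.of fun i => w (s.points i))

theorem faceDet_reindex (w : E (n + 1) → Fin (n + 1) → ℝ) (s : Splx (n + 1) n)
    (σ : Equiv.Perm (Fin (n + 1))) :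
    faceDet w (s.reindex σ) = ((Equiv.Perm.sign σ : ℤˣ) : ℤ) • faceDet w s := by
  have h := Matrix.det_permute σ.symm (Matrix.of fun i => w (s.points i))
  rw [Equiv.Perm.sign_symm] at h
  rw [zsmul_eq_mul]
  exact h

/-- Laplace expansion along the column of ones, for an arbitrary `w`; it serves both volume and
circumcenter. -/
theorem sum_faceDet_facet (w : E (n + 1) → Fin (n + 1) → ℝ) (s : Splx (n + 1) (n + 1)) :
    ∑ i : Fin (n + 2), (-1 : ℤ) ^ (i : ℕ) • faceDet w (facet s i) = (homMatrix w s).det := by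
  rw [Matrix.det_succ_column_zero]
  refine Finset.sum_congr rfl fun i _ => ?_
  rw [zsmul_eq_mul]
  simp only [homMatrix, Matrix.of_apply, Fin.cons_zero, mul_one]
  push_cast
  rfl

/-- The matrix with rows `(1, vᵢ)`. -/
abbrev vertexMatrix (s : Splx d d) : Matrix (Fin (d + 1)) (Fin (d + 1)) ℝ :=
  homMatrix (fun v => v.ofLp) s

/-- Coordinates of a point with the `k`-th one replaced by half the squared norm. -/
def halfSqCoords (k : Fin d) (v : E d) : Fin d → ℝ :=
  Function.update v.ofLp k (‖v‖ ^ 2 / 2)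

theorem det_homMatrix_halfSqCoords (s : Splx d d) (k : Fin d) :
    (homMatrix (halfSqCoords k) s).det = (vertexMatrix s).det * s.circumcenter k := by
  set o := s.circumcenter with ho
  -- The solution of the linear system for the circumcenter.
  set x : Fin (d + 1) → ℝ := Fin.cons ((s.circumradius ^ 2 - ‖o‖ ^ 2) / 2) o.ofLp with hx
  have hv : ∀ i, ‖s.points i‖ ^ 2 / 2 = (vertexMatrix s).mulVec x i := by
    intro i
    have h1 : ‖s.points i - o‖ ^ 2 = s.circumradius ^ 2 := by
      rw [← dist_eq_norm, ho, s.dist_circumcenter_eq_circumradius]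
    rw [norm_sub_sq_real, real_inner_comm, PiLp.inner_apply] at h1
    simp only [RCLike.inner_apply, conj_trivial] at h1
    rw [Matrix.mulVec, dotProduct, Fin.sum_univ_succ]
    simp only [hx, homMatrix, Matrix.of_apply, Fin.cons_zero, Fin.cons_succ, one_mul]
    linarith
  have hm : homMatrix (halfSqCoords k) s =
      (vertexMatrix s).updateCol k.succ ((vertexMatrix s).mulVec x) := by
    ext i j
    rw [Matrix.updateCol_apply]
    split_ifs with h
    · subst h
      rw [← hv]
      simp [homMatrix, halfSqCoords]
    · refine Fin.cases ?_ (fun j h => ?_) j h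
      · simp [homMatrix]
      · have : j ≠ k := fun e => h (by rw [e])
        simp [homMatrix, halfSqCoords, this]
  -- `adjugate A * A = det A • 1`, so Cramer's rule needs no invertibility.
  rw [hm, ← Matrix.cramer_apply, Matrix.cramer_eq_adjugate_mulVec, Matrix.mulVec_mulVec,
    Matrix.adjugate_mul, Matrix.smul_mulVec, Matrix.one_mulVec]
  simp [hx]

end Determinants

/-! ### Signed volume as a determinant -/

section Volume

variable {d : ℕ}

/-- The vertices `0, e₁, …, e_d` of the standard corner simplex. -/
def cornerPoints (d : ℕ) : Fin (d + 1) → E d :=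
  Fin.cons 0 fun j => EuclideanSpace.single j 1

/-- The volume of the standard corner simplex. -/
def cornerVolume (d : ℕ) : ℝ :=
  MeasureTheory.volume.real (convexHull ℝ (Set.range (cornerPoints d)))

/-- The matrix with rows `vᵢ - v₀`. -/
def edgeMatrix (s : Splx d d) : Matrix (Fin d) (Fin d) ℝ :=
  Matrix.of fun i j => s.points i.succ j - s.points 0 j

theorem det_vertexMatrix (s : Splx d d) : (vertexMatrix s).det = (edgeMatrix s).det := by
  have h : (vertexMatrix s).det = (Matrix.of fun i : Fin (d + 1) => Fin.cases (vertexMatrix s 0)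
      -- Subtracting row `0` from the others clears the column of ones below the top entry.
      (fun i j => vertexMatrix s i.succ j - vertexMatrix s 0 j) i :
        Matrix (Fin (d + 1)) (Fin (d + 1)) ℝ).det := by
    refine Matrix.det_eq_of_forall_row_eq_smul_add_const (fun i => if i = 0 then 0 else 1) 0
      (by simp) fun i j => ?_
    refine Fin.cases ?_ (fun i => ?_) i <;> simp
  rw [h, Matrix.det_succ_column_zero, Fin.sum_univ_succ, Finset.sum_eq_zero, add_zero]
  · simp only [Matrix.of_apply, Fin.val_zero, pow_zero, Fin.cases_zero, one_mul, homMatrix,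
      Fin.cons_zero]
    congr 1
  · intro i _
    simp [homMatrix]

/-- The simplex is the translate by `v₀` of a linear image of the corner simplex. The value of
`cornerVolume d` is never needed: it is a common factor. -/
theorem volume_convexHull (s : Splx d d) :
    MeasureTheory.volume.real (convexHull ℝ (Set.range s.points)) =
      |(vertexMatrix s).det| * cornerVolume d := by
  set L : E d →ₗ[ℝ] E d := Matrix.toLin (EuclideanSpace.basisFun (Fin d) ℝ).toBasis
    (EuclideanSpace.basisFun (Fin d) ℝ).toBasis (edgeMatrix s).transpose with hL
  have hLe : ∀ i, L (EuclideanSpace.single i 1) = s.points i.succ - s.points 0 := by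
    intro i
    have := Matrix.toLin_self (EuclideanSpace.basisFun (Fin d) ℝ).toBasis
      (EuclideanSpace.basisFun (Fin d) ℝ).toBasis (edgeMatrix s).transpose i
    simp only [OrthonormalBasis.coe_toBasis, EuclideanSpace.basisFun_apply] at this
    rw [hL, this]
    ext j
    simp [edgeMatrix, Finset.sum_apply, Pi.single_apply]
  have hdet : LinearMap.det L = (vertexMatrix s).det := by
    rw [hL, LinearMap.det_toLin, Matrix.det_transpose, det_vertexMatrix]
  have hr : Set.range s.points = (fun x => s.points 0 + x) '' (L '' Set.range (cornerPoints d)) := by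
    rw [← Set.range_comp, ← Set.range_comp]
    congr 1
    ext i : 1
    refine Fin.cases ?_ (fun i => ?_) i <;> simp [cornerPoints, hLe]
  have hc : convexHull ℝ (Set.range s.points) =
      (fun x => s.points 0 + x) '' (L '' convexHull ℝ (Set.range (cornerPoints d))) := by
    rw [hr, LinearMap.image_convexHull]
    exact ((AffineEquiv.constVAdd ℝ (E d) (s.points 0)).toAffineMap.image_convexHull _).symm
  rw [hc, MeasureTheory.measureReal_def, Set.image_add_left, MeasureTheory.measure_preimage_add,
    MeasureTheory.Measure.addHaar_image_linearMap, hdet, ENNReal.toReal_mul,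
    ENNReal.toReal_ofReal (abs_nonneg _)]
  rfl

theorem signedVolume_eq (s : Splx d d) :
    signedVolume s = cornerVolume d * (vertexMatrix s).det := by
  have ho : orientationSign s = (SignType.sign (vertexMatrix s).det : SignType) := rfl
  rw [signedVolume, volume_convexHull, ho, ← mul_assoc, mul_comm]
  congr 1
  exact_mod_cast sign_mul_abs (vertexMatrix s).det

end Volume

/-! ### Volume and circumcenter sum as functionals of the boundary -/

section Factorization

variable {R : Type*} [CommRing R] [Algebra R ℝ] {n : ℕ}

/-- The functional on hypersurface chains whose value on a boundary is the enclosed volume. -/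
def boundaryVolume : Chain R (n + 1) n →ₗ[R] ℝ :=
  liftAlternating (fun s => cornerVolume (n + 1) • faceDet (fun v => v.ofLp) s) fun s σ => by
    rw [faceDet_reindex, smul_comm]

theorem totalVolume_eq (K : Chain R (n + 1) (n + 1)) :
    totalVolume K = boundaryVolume (boundary K) := by
  refine LinearMap.congr_fun (g := boundaryVolume ∘ₗ boundary) (chain_hom_ext fun s => ?_) K
  rw [LinearMap.comp_apply, boundary_oriented, map_sum, totalVolume, liftAlternating_oriented,
    signedVolume_eq, vertexMatrix, ← sum_faceDet_facet, Finset.mul_sum]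
  refine Finset.sum_congr rfl fun i _ => ?_
  rw [map_zsmul, boundaryVolume, liftAlternating_oriented, smul_eq_mul, mul_smul_comm]

/-- The functional on hypersurface chains whose value on a boundary is the volume-weighted sum of
circumcenters of any filling. -/
def boundaryCircumcenterSum : Chain R (n + 1) n →ₗ[R] E (n + 1) :=
  liftAlternating (fun s => cornerVolume (n + 1) •
    WithLp.toLp 2 fun k => faceDet (halfSqCoords k) s) fun s σ => by
      ext k
      simp only [faceDet_reindex, PiLp.smul_apply, smul_eq_mul, mul_smul_comm]

theorem circumcenterSum_eq (K : Chain R (n + 1) (n + 1)) :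
    circumcenterSum K = boundaryCircumcenterSum (boundary K) := by
  refine LinearMap.congr_fun (g := boundaryCircumcenterSum ∘ₗ boundary)
    (chain_hom_ext fun s => ?_) K
  rw [LinearMap.comp_apply, boundary_oriented, map_sum, circumcenterSum, liftAlternating_oriented]
  ext k
  rw [PiLp.smul_apply, signedVolume_eq, smul_eq_mul, mul_assoc, ← det_homMatrix_halfSqCoords,
    ← sum_faceDet_facet, Finset.mul_sum, WithLp.ofLp_sum, Finset.sum_apply]
  refine Finset.sum_congr rfl fun i _ => ?_
  rw [map_zsmul, boundaryCircumcenterSum, liftAlternating_oriented]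
  simp only [PiLp.smul_apply, smul_eq_mul, mul_smul_comm]

end Factorization

end PLChain

end

theorem mainTheorem3 (R : Type*) [CommRing R] [Algebra R ℝ] (n : ℕ) :
    (∀ C : PLChain.Chain R (n + 1) (n + 1), PLChain.IsCycle C →
      PLChain.circumcenterSum C = 0) ∧
    (∀ C : PLChain.Chain R (n + 1) n, PLChain.IsCycle C →
      (∃ K : PLChain.Chain R (n + 1) (n + 1), PLChain.boundary K = C) ∧
      ∀ K K' : PLChain.Chain R (n + 1) (n + 1),
        PLChain.boundary K = C → PLChain.boundary K' = C →
          PLChain.totalVolume K = PLChain.totalVolume K' ∧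
          PLChain.circumcenterSum K = PLChain.circumcenterSum K' ∧
          (PLChain.totalVolume K ≠ 0 →
            PLChain.circumcenterOfMass K = PLChain.circumcenterOfMass K')) := by
  refine ⟨fun C hC => ?_, fun C hC => ⟨PLChain.exists_boundary_eq hC n.lt_succ_self, ?_⟩⟩
  · have h : PLChain.boundary C = 0 := hC
    rw [PLChain.circumcenterSum_eq, h, map_zero]
  · intro K K' hK hK'
    have hV : PLChain.totalVolume K = PLChain.totalVolume K' := by
      rw [PLChain.totalVolume_eq, PLChain.totalVolume_eq, hK, hK']
    have hM : PLChain.circumcenterSum K = PLChain.circumcenterSum K' := by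
      rw [PLChain.circumcenterSum_eq, PLChain.circumcenterSum_eq, hK, hK']
    exact ⟨hV, hM, fun _ => by
      rw [PLChain.circumcenterOfMass, PLChain.circumcenterOfMass, hV, hM]⟩
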